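/- Let $K\ge 1$, let $N_0,N_1,\dots,N_K$ be positive integers and let $q\ge 0$. For $k=1,\dots,K$ let $Q_k$ be a random complex matrix of size $N_k\times N_{k-1}$ with i.i.d. circularly-symmetric complex Gaussian entries of zero mean and unit variance (density $e^{-|z|^2}/\pi$ on $\mathbb{C}$), and let $Q_1,\dots,Q_K$ be independent. Put $H=Q_KQ_{K-1}\cdots Q_1$ (the Rayleigh product channel with dimensions $(N_0,\dots,N_K)$) and define its ergodic capacity by $$\tilde R_q(N_0,N_1,\dots,N_K)=\mathbb{E}\left[\ln\det\left(I+q\,H^{\dagger}H\right)\right],$$ where $H^\dagger$ is the conjugate transpose of $H$. Then this expectation exists and is finite, and it is invariant under permutations of the dimensions: for every permutation $\sigma$ of $\{0,1,\dots,K\}$, $$\tilde R_q(N_{\sigma(0)},N_{\sigma(1)},\dots,N_{\sigma(K)})=\tilde R_q(N_0,N_1,\dots,N_K).$$ -/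

import Mathlib

open MeasureTheory ProbabilityTheory
open scoped Matrix

namespace RayleighProduct

/-- The standard circularly-symmetric complex Gaussian law (zero mean, unit variance): the law of
`x + i y` with `x`, `y` independent real Gaussians of mean `0` and variance `1 / 2`; its density
with respect to Lebesgue measure on `ℂ` is `exp (-|z|²) / π`. -/
noncomputable def complexGaussian : Measure ℂ :=
  ((gaussianReal 0 (1 / 2)).prod (gaussianReal 0 (1 / 2))).map (fun p : ℝ × ℝ => Complex.mk p.1 p.2)

/-- The entries of the component channels `Q₁, …, Q_K` with dimensions `(N₀, …, N_K)`. The index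
`k : Fin K` stands for the channel `Q_{k+1}`, whose matrix `Matrix.of (Q k)` is of size
`N_{k+1} × N_k`. -/
abbrev Channels {K : ℕ} (N : Fin (K + 1) → ℕ) : Type :=
  (k : Fin K) → Fin (N k.succ) → Fin (N k.castSucc) → ℂ

/-- The joint law of the component channels: they are independent, and all their entries are
i.i.d. standard complex Gaussian variables. -/
noncomputable def rayleighLaw {K : ℕ} (N : Fin (K + 1) → ℕ) : Measure (Channels N) :=
  Measure.pi fun k : Fin K => Measure.pi fun _ : Fin (N k.succ) =>
    Measure.pi fun _ : Fin (N k.castSucc) => complexGaussian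

/-- The product channel `H = Q_K * Q_{K-1} * ⋯ * Q₁`, of size `N_K × N₀`. -/
noncomputable def productChannel {K : ℕ} {N : Fin (K + 1) → ℕ} (Q : Channels N) :
    Matrix (Fin (N (Fin.last K))) (Fin (N 0)) ℂ :=
  Fin.induction (motive := fun k => Matrix (Fin (N k)) (Fin (N 0)) ℂ)
    1 (fun k P => Matrix.of (Q k) * P) (Fin.last K)

/-- The capacity `ln det (I + q Hᴴ H)` (nats per channel use) of a realization of the channels.
For `q ≥ 0` the determinant is a positive real number, so it equals its real part. -/
noncomputable def capacity {K : ℕ} {N : Fin (K + 1) → ℕ} (q : ℝ) (Q : Channels N) : ℝ :=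
  Real.log (1 + (q : ℂ) • ((productChannel Q)ᴴ * productChannel Q)).det.re

/-- The ergodic capacity: the expectation of the capacity under the law of the channels. -/
noncomputable def ergodicCapacity {K : ℕ} (N : Fin (K + 1) → ℕ) (q : ℝ) : ℝ :=
  ∫ Q : Channels N, capacity q Q ∂(rayleighLaw N)

end RayleighProduct

/-! Fix `d` at least as large as every `N k`, and let `J k` be the inclusion of `N k` coordinates
into `d`. Each channel is a corner block of a `d × d` Gaussian matrix, so it is `(J k.succ)ᴴ * G k *
J k.castSucc`. Padding `H` by `J` at both ends leaves the capacity unchanged and gives `P_K G_K ⋯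
P_1 G_1 P_0`, with `P_k = J_k J_kᴴ` Hermitian. The expectation thus depends only on the list of the
`P_k`, and it suffices to swap neighbours.

If `ψ Mᴴ = ψ M`, then `ψ (Q G P)` and `ψ (P G Q)` have the same mean, because `Gᴴ` has the law of
`G` (`lintegral_mul_mul_swap`). The symmetry of `ψ` comes from the singular value decomposition: `Mᴴ
= W M W` with `W` unitary (`exists_unitary_conjTranspose_eq`), and each `W` is absorbed by a
neighbouring Gaussian factor or by the biunitary invariance of the log-determinant.

Finiteness follows from `logDet q X ≤ q ‖X‖²` in the submultiplicative Frobenius norm. -/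

namespace RayleighProduct

/-! ### Singular values and the relation between a matrix and its adjoint -/

section LinearAlgebra

open scoped ComplexOrder

variable {d : ℕ}

/-- In an eigenbasis `U` of `Mᴴ M`, the columns of `M U` are orthogonal with squared lengths the
eigenvalues. The nonzero ones are normalized and completed to an orthonormal basis, which gives `V`.
-/
theorem exists_singularValueDecomposition (M : Matrix (Fin d) (Fin d) ℂ) :
    ∃ (U V : Matrix.unitaryGroup (Fin d) ℂ) (s : Fin d → ℝ),
      M = (V : Matrix (Fin d) (Fin d) ℂ) * Matrix.diagonal (fun i => (s i : ℂ)) *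
        (U : Matrix (Fin d) (Fin d) ℂ)ᴴ := by
  have hA : (Mᴴ * M).PosSemidef := Matrix.posSemidef_conjTranspose_mul_self M
  set l := hA.isHermitian.eigenvalues with hl
  have hl0 : ∀ i, 0 ≤ l i := hA.eigenvalues_nonneg
  let U := hA.isHermitian.eigenvectorUnitary
  have hUU : (U : Matrix (Fin d) (Fin d) ℂ)ᴴ * U = 1 := Unitary.coe_star_mul_self U
  have hUU' : (U : Matrix (Fin d) (Fin d) ℂ) * (U : Matrix (Fin d) (Fin d) ℂ)ᴴ = 1 :=
    Unitary.coe_mul_star_self U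
  have hspec := hA.isHermitian.spectral_theorem
  rw [Unitary.conjStarAlgAut_apply] at hspec
  set N := M * (U : Matrix (Fin d) (Fin d) ℂ) with hN
  have hNN : Nᴴ * N = Matrix.diagonal (fun i => (l i : ℂ)) := by
    have : Nᴴ * N = (U : Matrix (Fin d) (Fin d) ℂ)ᴴ * (Mᴴ * M) * U := by
      simp only [hN, Matrix.conjTranspose_mul, Matrix.mul_assoc]
    rw [this, hspec]
    change (U : Matrix (Fin d) (Fin d) ℂ)ᴴ * (U * Matrix.diagonal (fun i => (l i : ℂ)) *
      (U : Matrix (Fin d) (Fin d) ℂ)ᴴ) * U = _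
    rw [← Matrix.mul_assoc, ← Matrix.mul_assoc, hUU, Matrix.one_mul, Matrix.mul_assoc, hUU,
      Matrix.mul_one]
  let c : Fin d → EuclideanSpace ℂ (Fin d) := fun j => WithLp.toLp 2 fun i => N i j
  have hc : ∀ i j, inner ℂ (c i) (c j) = if i = j then (l i : ℂ) else 0 := by
    intro i j
    have := congrFun (congrFun hNN i) j
    rw [Matrix.diagonal_apply] at this
    rw [← this]
    simp [c, PiLp.inner_apply, Matrix.mul_apply, mul_comm]
  let v : Fin d → EuclideanSpace ℂ (Fin d) := fun i => ((√(l i))⁻¹ : ℂ) • c i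
  have hv : Orthonormal ℂ (({i | l i ≠ 0} : Set (Fin d)).domRestrict v) := by
    rw [orthonormal_iff_ite]
    rintro ⟨i, hi⟩ ⟨j, hj⟩
    simp only [Set.domRestrict_apply, v, inner_smul_left, inner_smul_right, hc, Subtype.mk.injEq]
    split_ifs with h
    · subst h
      have h1 : ((√(l i) : ℝ) : ℂ) * √(l i) = l i := by
        rw [← Complex.ofReal_mul, Real.mul_self_sqrt (hl0 i)]
      have h2 : ((√(l i) : ℝ) : ℂ) ≠ 0 := by
        simpa [Real.sqrt_eq_zero (hl0 i)] using hi
      rw [← h1]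
      simp only [map_inv₀, Complex.conj_ofReal]
      field_simp
    · simp
  obtain ⟨b, hb⟩ := hv.exists_orthonormalBasis_extension_of_card_eq (by simp)
  have hcb : ∀ j, c j = ((√(l j) : ℝ) : ℂ) • b j := by
    intro j
    by_cases h : l j = 0
    · have : c j = 0 := by
        rw [← inner_self_eq_zero (𝕜 := ℂ), hc, if_pos rfl, h, Complex.ofReal_zero]
      simp [this, h]
    · have h2 : ((√(l j) : ℝ) : ℂ) ≠ 0 := by
        simpa [Real.sqrt_eq_zero (hl0 j)] using h
      rw [hb j h]
      simp [v, smul_smul, h2]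
  let V : Matrix (Fin d) (Fin d) ℂ := Matrix.of fun i j => b j i
  have hV : Vᴴ * V = 1 := by
    ext i j
    have := orthonormal_iff_ite.1 b.orthonormal i j
    rw [Matrix.one_apply, ← this]
    simp [V, PiLp.inner_apply, Matrix.mul_apply, mul_comm]
  refine ⟨U, ⟨V, Matrix.mem_unitaryGroup_iff'.2 hV⟩, fun i => √(l i), ?_⟩
  have hNV : N = V * Matrix.diagonal (fun i => ((√(l i) : ℝ) : ℂ)) := by
    ext i j
    rw [Matrix.mul_diagonal]
    have := congrArg (fun x : EuclideanSpace ℂ (Fin d) => x i) (hcb j)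
    simpa [c, V, mul_comm] using this
  change M = V * Matrix.diagonal (fun i => ((√(l i) : ℝ) : ℂ)) * _
  rw [← hNV, hN, Matrix.mul_assoc, hUU', Matrix.mul_one]

/-- With `M = V D Uᴴ` and `D` real, `Mᴴ = U D Vᴴ`, so `W = U Vᴴ` works on both sides. -/
theorem exists_unitary_conjTranspose_eq (M : Matrix (Fin d) (Fin d) ℂ) :
    ∃ W ∈ Matrix.unitaryGroup (Fin d) ℂ, Mᴴ = W * M * W := by
  obtain ⟨U, V, s, h⟩ := exists_singularValueDecomposition M
  refine ⟨U * star V, (U * star V).2, ?_⟩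
  have hUU : (U : Matrix (Fin d) (Fin d) ℂ)ᴴ * U = 1 := Unitary.coe_star_mul_self U
  have hVV : (V : Matrix (Fin d) (Fin d) ℂ)ᴴ * V = 1 := Unitary.coe_star_mul_self V
  set D := Matrix.diagonal (fun i => (s i : ℂ))
  have hD : Dᴴ = D := by
    simp [D, Matrix.diagonal_conjTranspose, Pi.star_def]
  have hl : Mᴴ = (U : Matrix (Fin d) (Fin d) ℂ) * D * (V : Matrix (Fin d) (Fin d) ℂ)ᴴ := by
    rw [h]
    simp [hD, Matrix.mul_assoc]
  rw [hl, h]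
  calc (U : Matrix (Fin d) (Fin d) ℂ) * D * (V : Matrix (Fin d) (Fin d) ℂ)ᴴ
      = U * (((V : Matrix (Fin d) (Fin d) ℂ)ᴴ * V) * D *
          ((U : Matrix (Fin d) (Fin d) ℂ)ᴴ * U)) * (V : Matrix (Fin d) (Fin d) ℂ)ᴴ := by
        rw [hUU, hVV, Matrix.one_mul, Matrix.mul_one]
    _ = _ := by simp only [Matrix.mul_assoc, Unitary.coe_star, Matrix.star_eq_conjTranspose]

end LinearAlgebra

/-! ### Unitary invariance of complex Gaussian vectors -/

section Gaussian

instance isProbabilityMeasure_complexGaussian : IsProbabilityMeasure complexGaussian :=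
  Measure.isProbabilityMeasure_map
    (by exact (Complex.measurableEquivRealProd.symm.measurable).aemeasurable)

theorem measurable_complexMk : Measurable fun p : ℝ × ℝ => Complex.mk p.1 p.2 :=
  Complex.measurableEquivRealProd.symm.measurable

theorem charFun_complexGaussian (t : ℂ) :
    charFun complexGaussian t = Complex.exp (-((‖t‖ ^ 2 : ℝ) : ℂ) / 4) := by
  rw [charFun_apply, complexGaussian, integral_map measurable_complexMk.aemeasurable
    (by fun_prop)]
  have h : ∀ p : ℝ × ℝ, Complex.exp (((inner ℝ (Complex.mk p.1 p.2) t : ℝ) : ℂ) * Complex.I) =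
      Complex.exp (t.re * p.1 * Complex.I) * Complex.exp (t.im * p.2 * Complex.I) := by
    intro p
    rw [← Complex.exp_add, Complex.inner]
    congr 1
    simp only [Complex.mul_re, Complex.conj_re, Complex.conj_im]
    push_cast
    ring
  simp_rw [h]
  rw [integral_prod_mul (fun x : ℝ => Complex.exp (t.re * x * Complex.I))
    (fun y : ℝ => Complex.exp (t.im * y * Complex.I)), ← charFun_apply_real, ← charFun_apply_real,
    charFun_gaussianReal, charFun_gaussianReal, ← Complex.exp_add, ← Complex.normSq_eq_norm_sq,
    Complex.normSq_apply]
  congr 1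
  push_cast
  ring

theorem integrable_norm_sq_complexGaussian :
    Integrable (fun z : ℂ => ‖z‖ ^ 2) complexGaussian := by
  rw [complexGaussian, integrable_map_measure (by fun_prop) measurable_complexMk.aemeasurable]
  have h : Integrable (fun x : ℝ => x ^ 2) (gaussianReal 0 (1 / 2)) :=
    (memLp_id_gaussianReal (μ := 0) (v := 1 / 2) 2).integrable_sq
  refine ((h.comp_fst _).add (h.comp_snd _)).congr (ae_of_all _ fun p => ?_)
  rw [Function.comp_apply, ← Complex.normSq_eq_norm_sq, Complex.normSq_apply]
  simp only [Pi.add_apply, sq]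

theorem measurePreserving_conj_complexGaussian :
    MeasurePreserving (star : ℂ → ℂ) complexGaussian complexGaussian := by
  have hs : Measurable (star : ℂ → ℂ) := continuous_star.measurable
  refine ⟨hs, ?_⟩
  have : IsProbabilityMeasure (complexGaussian.map star) :=
    Measure.isProbabilityMeasure_map hs.aemeasurable
  refine Measure.ext_of_charFun (funext fun t => ?_)
  have h : charFun (complexGaussian.map star) t = charFun complexGaussian (star t) := by
    rw [charFun_apply, charFun_apply, integral_map hs.aemeasurable (by fun_prop)]
    congr with z
    simp [Complex.inner]
  rw [h, charFun_complexGaussian, charFun_complexGaussian, norm_star]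

theorem charFun_pi_complexGaussian {n : ℕ} (t : EuclideanSpace ℂ (Fin n)) :
    charFun ((Measure.pi fun _ : Fin n => complexGaussian).map (WithLp.toLp 2)) t =
      Complex.exp (-((‖t‖ ^ 2 : ℝ) : ℂ) / 4) := by
  rw [charFun_pi]
  simp_rw [charFun_complexGaussian]
  rw [← Complex.exp_sum, EuclideanSpace.norm_sq_eq]
  congr 1
  push_cast
  rw [← Finset.sum_div, Finset.sum_neg_distrib]

/-- The characteristic function depends only on `‖t‖`, and the adjoint map `t ↦ t Wᴴ` preserves the
norm. -/
theorem measurePreserving_vecMul_pi_complexGaussian {n : ℕ} {W : Matrix (Fin n) (Fin n) ℂ}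
    (hW : W ∈ Matrix.unitaryGroup (Fin n) ℂ) :
    MeasurePreserving (fun x : Fin n → ℂ => x ᵥ* W) (Measure.pi fun _ => complexGaussian)
      (Measure.pi fun _ => complexGaussian) := by
  have hm : Measurable fun x : Fin n → ℂ => x ᵥ* W :=
    (continuous_id.matrix_vecMul continuous_const).measurable
  refine ⟨hm, ?_⟩
  have hto : Measurable (WithLp.toLp 2 : (Fin n → ℂ) → EuclideanSpace ℂ (Fin n)) := by fun_prop
  have hprob : IsProbabilityMeasure
      ((Measure.pi fun _ : Fin n => complexGaussian).map fun x : Fin n → ℂ => x ᵥ* W) :=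
    Measure.isProbabilityMeasure_map hm.aemeasurable
  suffices h : ((Measure.pi fun _ : Fin n => complexGaussian).map fun x => x ᵥ* W).map
      (WithLp.toLp 2) = (Measure.pi fun _ : Fin n => complexGaussian).map
        (WithLp.toLp 2 : (Fin n → ℂ) → EuclideanSpace ℂ (Fin n)) from
    (MeasurableEquiv.toLp 2 (Fin n → ℂ)).map_measurableEquiv_injective h
  have h1 := Measure.isProbabilityMeasure_map (μ := (Measure.pi fun _ : Fin n =>
    complexGaussian).map fun x : Fin n → ℂ => x ᵥ* W) hto.aemeasurable
  have h2 := Measure.isProbabilityMeasure_map (μ := Measure.pi fun _ : Fin n =>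
    complexGaussian) hto.aemeasurable
  refine Measure.ext_of_charFun (funext fun t => ?_)
  have hadj : ∀ x : Fin n → ℂ, inner ℝ (WithLp.toLp 2 (x ᵥ* W)) t =
      inner ℝ (WithLp.toLp 2 x) (WithLp.toLp 2 (t.ofLp ᵥ* Wᴴ)) := by
    intro x
    simp only [PiLp.inner_apply, Complex.inner, ← Complex.re_sum]
    congr 1
    simp only [Matrix.vecMul, dotProduct, map_sum, map_mul, Finset.mul_sum, Finset.sum_mul,
      Matrix.conjTranspose_apply]
    rw [Finset.sum_comm]
    refine Finset.sum_congr rfl fun i _ => Finset.sum_congr rfl fun j _ => ?_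
    simp only [RCLike.star_def]
    ring
  have h : charFun (((Measure.pi fun _ : Fin n => complexGaussian).map fun x => x ᵥ* W).map
      (WithLp.toLp 2)) t = charFun ((Measure.pi fun _ : Fin n => complexGaussian).map
        (WithLp.toLp 2)) (WithLp.toLp 2 (t.ofLp ᵥ* Wᴴ)) := by
    rw [charFun_apply, charFun_apply, Measure.map_map hto hm,
      integral_map (hto.comp hm).aemeasurable (by fun_prop),
      integral_map hto.aemeasurable (by fun_prop)]
    simp only [Function.comp_apply, hadj]
  rw [h, charFun_pi_complexGaussian, charFun_pi_complexGaussian]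
  congr 4
  have hnorm : ∀ u : EuclideanSpace ℂ (Fin n), ((‖u‖ ^ 2 : ℝ) : ℂ) = u.ofLp ⬝ᵥ star u.ofLp := by
    intro u
    rw [EuclideanSpace.norm_sq_eq]
    simp [dotProduct, Complex.mul_conj, Complex.normSq_eq_norm_sq]
  have : ((‖(WithLp.toLp 2 (t.ofLp ᵥ* Wᴴ) : EuclideanSpace ℂ (Fin n))‖ ^ 2 : ℝ) : ℂ) =
      ((‖t‖ ^ 2 : ℝ) : ℂ) := by
    have hWW : Wᴴ * W = 1 := Matrix.mem_unitaryGroup_iff'.1 hW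
    rw [hnorm, hnorm, Matrix.star_vecMul, Matrix.conjTranspose_conjTranspose,
      Matrix.dotProduct_mulVec, Matrix.vecMul_vecMul, hWW, Matrix.vecMul_one]
  exact_mod_cast this

end Gaussian

end RayleighProduct

namespace RayleighProduct

/-! ### Transposing and selecting coordinates of product measures -/

section ProductMeasures

theorem measurePreserving_pi_pi_swap {ι κ α : Type*} [Fintype ι] [Fintype κ] [MeasurableSpace α]
    (ν : Measure α) [IsProbabilityMeasure ν] :
    MeasurePreserving (fun (G : ι → κ → α) (j : κ) (i : ι) => G i j)
      (Measure.pi fun _ => Measure.pi fun _ => ν) (Measure.pi fun _ => Measure.pi fun _ => ν) := by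
  have hm : Measurable (fun (G : ι → κ → α) (j : κ) (i : ι) => G i j) := by fun_prop
  refine ⟨hm, Eq.symm ?_⟩
  -- Boxes whose sides are themselves boxes form a generating π-system that transposition respects;
  -- on them both measures are the same double product.
  refine Measure.pi_eq_generateFrom
    (C := fun _ => Set.pi Set.univ '' Set.pi Set.univ fun _ : ι => {s : Set α | MeasurableSet s})
    (fun _ => generateFrom_pi) (fun _ => isPiSystem_pi)
    (fun _ => ⟨fun _ => Set.univ, fun _ => ⟨fun _ => Set.univ, by simp, by simp⟩,
      fun _ => by simp, by simp [Set.iUnion_const]⟩) fun s hs => ?_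
  choose t ht hts using hs
  have hpre : (fun (G : ι → κ → α) (j : κ) (i : ι) => G i j) ⁻¹' Set.pi Set.univ s =
      Set.pi Set.univ fun i => Set.pi Set.univ fun j => t j i := by
    ext G
    simp only [← hts, Set.mem_preimage, Set.mem_univ_pi]
    exact forall_comm
  have htm : ∀ j i, MeasurableSet (t j i) := fun j i => ht j i (Set.mem_univ i)
  rw [Measure.map_apply hm, hpre]
  · simp only [← hts, Measure.pi_pi]
    exact Finset.prod_comm
  · exact MeasurableSet.univ_pi fun j => hts j ▸ MeasurableSet.univ_pi (htm j)

theorem measurePreserving_comp_injective {ι κ α : Type*} [Fintype ι] [Fintype κ]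
    [MeasurableSpace α] (ν : Measure α) [IsProbabilityMeasure ν] {e : ι → κ}
    (he : Function.Injective e) :
    MeasurePreserving (fun (x : κ → α) (i : ι) => x (e i)) (Measure.pi fun _ => ν)
      (Measure.pi fun _ => ν) := by
  have h := (iIndepFun_pi (μ := fun _ : κ => ν) (X := fun _ x => x)
    fun _ => aemeasurable_id).precomp he
  rw [iIndepFun_iff_map_fun_eq_pi_map fun i => (measurable_pi_apply _).aemeasurable] at h
  refine ⟨by fun_prop, h.trans ?_⟩
  congr with i : 1
  exact (measurePreserving_eval (fun _ : κ => ν) (e i)).map_eq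

end ProductMeasures

/-! ### Symmetries and second moment of square Gaussian matrices -/

section Ginibre

variable {d : ℕ}

noncomputable instance matrixMeasurableSpace : MeasurableSpace (Matrix (Fin d) (Fin d) ℂ) :=
  inferInstanceAs (MeasurableSpace (Fin d → Fin d → ℂ))

instance matrixBorelSpace : BorelSpace (Matrix (Fin d) (Fin d) ℂ) :=
  inferInstanceAs (BorelSpace (Fin d → Fin d → ℂ))

instance matrixSecondCountableTopology : SecondCountableTopology (Matrix (Fin d) (Fin d) ℂ) :=
  inferInstanceAs (SecondCountableTopology (Fin d → Fin d → ℂ))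

/-- The law of a `d × d` matrix with i.i.d. standard complex Gaussian entries. -/
noncomputable def ginibre (d : ℕ) : Measure (Matrix (Fin d) (Fin d) ℂ) :=
  (Measure.pi fun _ => Measure.pi fun _ => complexGaussian : Measure (Fin d → Fin d → ℂ))

instance isProbabilityMeasure_ginibre : IsProbabilityMeasure (ginibre d) :=
  inferInstanceAs (IsProbabilityMeasure
    (Measure.pi fun _ => Measure.pi fun _ => complexGaussian : Measure (Fin d → Fin d → ℂ)))

theorem measurePreserving_conjTranspose_ginibre :
    MeasurePreserving (fun G => Gᴴ) (ginibre d) (ginibre d) := by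
  have h1 : MeasurePreserving (fun (G : Fin d → Fin d → ℂ) i j => star (G i j))
      (Measure.pi fun _ => Measure.pi fun _ => complexGaussian)
      (Measure.pi fun _ => Measure.pi fun _ => complexGaussian) :=
    measurePreserving_pi _ _ fun _ => measurePreserving_pi _ _ fun _ =>
      measurePreserving_conj_complexGaussian
  exact h1.comp (measurePreserving_pi_pi_swap complexGaussian)

theorem measurePreserving_mul_right_ginibre {W : Matrix (Fin d) (Fin d) ℂ}
    (hW : W ∈ Matrix.unitaryGroup (Fin d) ℂ) :
    MeasurePreserving (fun G => G * W) (ginibre d) (ginibre d) :=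
  measurePreserving_pi _ _ fun _ => measurePreserving_vecMul_pi_complexGaussian hW

/-- Reduces to right multiplication through `W G = (Gᴴ Wᴴ)ᴴ`. -/
theorem measurePreserving_mul_left_ginibre {W : Matrix (Fin d) (Fin d) ℂ}
    (hW : W ∈ Matrix.unitaryGroup (Fin d) ℂ) :
    MeasurePreserving (fun G => W * G) (ginibre d) (ginibre d) := by
  have h := measurePreserving_conjTranspose_ginibre.comp
    ((measurePreserving_mul_right_ginibre (Unitary.star_mem hW)).comp
      measurePreserving_conjTranspose_ginibre)
  convert h using 2
  simp [Matrix.star_eq_conjTranspose]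

/-- The sum of the squared absolute values of the entries of a matrix. -/
noncomputable def frobeniusSq (X : Matrix (Fin d) (Fin d) ℂ) : ℝ := ∑ i, ∑ j, ‖X i j‖ ^ 2

theorem frobeniusSq_nonneg (X : Matrix (Fin d) (Fin d) ℂ) : 0 ≤ frobeniusSq X :=
  Finset.sum_nonneg fun _ _ => Finset.sum_nonneg fun _ _ => by positivity

section Frobenius

attribute [local instance] Matrix.frobeniusSeminormedAddCommGroup

theorem frobeniusSq_mul_le (X Y : Matrix (Fin d) (Fin d) ℂ) :
    frobeniusSq (X * Y) ≤ frobeniusSq X * frobeniusSq Y := by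
  have h : ∀ Z : Matrix (Fin d) (Fin d) ℂ, frobeniusSq Z = ‖Z‖ ^ 2 := by
    intro Z
    rw [Matrix.frobenius_norm_def, ← Real.sqrt_eq_rpow]
    simp_rw [Real.rpow_two]
    exact (Real.sq_sqrt (frobeniusSq_nonneg Z)).symm
  rw [h, h, h, ← mul_pow]
  gcongr
  exact Matrix.frobenius_norm_mul X Y

end Frobenius

theorem integrable_frobeniusSq_ginibre : Integrable frobeniusSq (ginibre d) := by
  refine integrable_finsetSum _ fun i _ => integrable_finsetSum _ fun j _ => ?_
  have h : MeasurePreserving (fun G : Fin d → Fin d → ℂ => G i j)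
      (Measure.pi fun _ => Measure.pi fun _ => complexGaussian) complexGaussian :=
    (measurePreserving_eval (fun _ : Fin d => complexGaussian) j).comp
      (measurePreserving_eval (fun _ : Fin d => Measure.pi fun _ : Fin d => complexGaussian) i)
  exact h.integrable_comp_of_integrable integrable_norm_sq_complexGaussian

theorem lintegral_frobeniusSq_ginibre_lt_top :
    ∫⁻ G, ENNReal.ofReal (frobeniusSq G) ∂(ginibre d) < ⊤ :=
  integrable_frobeniusSq_ginibre.lintegral_lt_top

end Ginibre

/-! ### Averages over Gaussian factors and permutation of the fixed factors -/

section Averages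

variable {d : ℕ}

/-- The expectation of `φ (Pₖ Gₖ ⋯ P₁ G₁ X)` for `L = [P₁, …, Pₖ]` and independent `Gᵢ` with i.i.d.
standard complex Gaussian entries. -/
noncomputable def average (φ : Matrix (Fin d) (Fin d) ℂ → ENNReal) :
    List (Matrix (Fin d) (Fin d) ℂ) → Matrix (Fin d) (Fin d) ℂ → ENNReal
  | [], X => φ X
  | P :: L, X => ∫⁻ G, average φ L (P * G * X) ∂(ginibre d)

/-- The expectation of `φ (Pₖ Gₖ ⋯ P₁ G₁ P₀)` for the list `[P₀, …, Pₖ]`. -/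
noncomputable def productAverage (φ : Matrix (Fin d) (Fin d) ℂ → ENNReal) :
    List (Matrix (Fin d) (Fin d) ℂ) → ENNReal
  | [] => 0
  | P :: L => average φ L P

/-- Invariance under multiplication by unitary matrices from both sides. -/
def IsBiunitarilyInvariant (φ : Matrix (Fin d) (Fin d) ℂ → ENNReal) : Prop :=
  ∀ W ∈ Matrix.unitaryGroup (Fin d) ℂ, ∀ X, φ (W * X) = φ X ∧ φ (X * W) = φ X

variable {φ : Matrix (Fin d) (Fin d) ℂ → ENNReal}

theorem measurable_average (hφ : Measurable φ) (L : List (Matrix (Fin d) (Fin d) ℂ)) :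
    Measurable (average φ L) := by
  induction L with
  | nil => exact hφ
  | cons P L ih =>
    refine Measurable.lintegral_prod_right' (f := fun p : Matrix (Fin d) (Fin d) ℂ × _ =>
      average φ L (P * p.2 * p.1)) (ih.comp (Continuous.measurable ?_))
    fun_prop

/-- A unitary to the left of `X` is absorbed by the adjacent Gaussian factor; one to the right
passes through the whole product to `φ`. -/
theorem IsBiunitarilyInvariant.average (hφ : Measurable φ) (h : IsBiunitarilyInvariant φ)
    (L : List (Matrix (Fin d) (Fin d) ℂ)) : IsBiunitarilyInvariant (average φ L) := by
  induction L with
  | nil => exact h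
  | cons P L ih =>
    intro W hW X
    constructor
    · simp only [RayleighProduct.average]
      have hm : Measurable fun G => RayleighProduct.average φ L (P * G * X) :=
        (measurable_average hφ L).comp (Continuous.measurable (by fun_prop))
      rw [← (measurePreserving_mul_right_ginibre hW).lintegral_comp hm]
      simp only [Matrix.mul_assoc]
    · simp only [RayleighProduct.average, ← Matrix.mul_assoc, (ih W hW _).2]

theorem IsBiunitarilyInvariant.conjTranspose (h : IsBiunitarilyInvariant φ)
    (M : Matrix (Fin d) (Fin d) ℂ) : φ Mᴴ = φ M := by
  obtain ⟨W, hW, hM⟩ := exists_unitary_conjTranspose_eq M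
  rw [hM, (h W hW _).2, (h W hW _).1]

/-- Substitute `Gᴴ` for `G`: `Q Gᴴ P` is the adjoint of `P G Q`. -/
theorem lintegral_mul_mul_swap {ψ : Matrix (Fin d) (Fin d) ℂ → ENNReal} (hψ : Measurable ψ)
    (hinv : ∀ M, ψ Mᴴ = ψ M) {P Q : Matrix (Fin d) (Fin d) ℂ} (hP : P.IsHermitian)
    (hQ : Q.IsHermitian) :
    ∫⁻ G, ψ (Q * G * P) ∂(ginibre d) = ∫⁻ G, ψ (P * G * Q) ∂(ginibre d) := by
  have hm : Measurable fun G => ψ (Q * G * P) :=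
    hψ.comp (Continuous.measurable (by fun_prop))
  rw [← measurePreserving_conjTranspose_ginibre.lintegral_comp hm]
  refine lintegral_congr fun G => ?_
  rw [← hinv (P * G * Q)]
  simp only [Matrix.conjTranspose_mul, hP.eq, hQ.eq, Matrix.mul_assoc]

theorem average_swap (hφ : Measurable φ) (h : IsBiunitarilyInvariant φ)
    {P Q : Matrix (Fin d) (Fin d) ℂ} (hP : P.IsHermitian) (hQ : Q.IsHermitian)
    (L : List (Matrix (Fin d) (Fin d) ℂ)) : average φ (P :: Q :: L) = average φ (Q :: P :: L) := by
  funext X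
  have hinv := h.average hφ L
  have hmeas := measurable_average hφ L
  -- `M` stands for the segment `Q G P`. In `Mᴴ = W M W` the right `W` is absorbed by the Gaussian
  -- factor next to `X`, the left one by the invariance of `average φ L`.
  set ψ : Matrix (Fin d) (Fin d) ℂ → ENNReal :=
    fun M => ∫⁻ G, average φ L (M * (G * X)) ∂(ginibre d) with hψ
  have hψm : Measurable ψ :=
    Measurable.lintegral_prod_right' (f := fun p : Matrix (Fin d) (Fin d) ℂ × _ =>
      average φ L (p.1 * (p.2 * X))) (hmeas.comp (Continuous.measurable (by fun_prop)))
  have hψinv : ∀ M, ψ Mᴴ = ψ M := by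
    intro M
    obtain ⟨W, hW, hM⟩ := exists_unitary_conjTranspose_eq M
    have hm : Measurable fun G => average φ L (M * (G * X)) :=
      hmeas.comp (Continuous.measurable (by fun_prop))
    simp only [hψ]
    rw [← (measurePreserving_mul_left_ginibre hW).lintegral_comp hm]
    refine lintegral_congr fun G => ?_
    rw [hM, Matrix.mul_assoc, Matrix.mul_assoc, (hinv W hW _).1, Matrix.mul_assoc]
  have key : ∀ P Q : Matrix (Fin d) (Fin d) ℂ,
      average φ (P :: Q :: L) X = ∫⁻ G, ψ (Q * G * P) ∂(ginibre d) := by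
    intro P Q
    simp only [average, hψ]
    have hm : Measurable fun p : Matrix (Fin d) (Fin d) ℂ × Matrix (Fin d) (Fin d) ℂ =>
        average φ L (Q * p.2 * (P * p.1 * X)) :=
      hmeas.comp (Continuous.measurable (by fun_prop))
    -- Tonelli makes the Gaussian factor between `P` and `Q` the outer variable.
    rw [lintegral_lintegral_swap (by exact hm.aemeasurable)]
    simp only [Matrix.mul_assoc]
  rw [key, key, lintegral_mul_mul_swap hψm hψinv hP hQ]

theorem average_perm (hφ : Measurable φ) (h : IsBiunitarilyInvariant φ)
    {L L' : List (Matrix (Fin d) (Fin d) ℂ)} (hL : L.Perm L') (hH : ∀ P ∈ L, P.IsHermitian) :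
    average φ L = average φ L' := by
  induction hL with
  | nil => rfl
  | cons P _ ih =>
    funext X
    simp only [average, ih fun Q hQ => hH Q (List.mem_cons_of_mem _ hQ)]
  | swap P Q L => exact average_swap hφ h (hH _ (by simp)) (hH _ (by simp)) L
  | trans h1 _ ih1 ih2 => exact (ih1 hH).trans (ih2 fun P hP => hH P (h1.mem_iff.2 hP))

/-- The first factor needs its own swap, as no Gaussian factor lies to its right; there `average φ
L` itself plays the role of `ψ`. -/
theorem productAverage_perm (hφ : Measurable φ) (h : IsBiunitarilyInvariant φ)
    {L L' : List (Matrix (Fin d) (Fin d) ℂ)} (hL : L.Perm L') (hH : ∀ P ∈ L, P.IsHermitian) :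
    productAverage φ L = productAverage φ L' := by
  induction hL with
  | nil => rfl
  | cons P hL =>
    exact congrFun (average_perm hφ h hL fun Q hQ => hH Q (List.mem_cons_of_mem _ hQ)) P
  | swap P Q L =>
    exact lintegral_mul_mul_swap (measurable_average hφ L) (h.average hφ L).conjTranspose
      (hH _ (by simp)) (hH _ (by simp))
  | trans h1 _ ih1 ih2 => exact (ih1 hH).trans (ih2 fun P hP => hH P (h1.mem_iff.2 hP))

/-- Each Gaussian factor is independent of the rest, so submultiplicativity costs only its finite
second moment. -/
theorem exists_average_le {C : ENNReal} (hC : C < ⊤)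
    (hφ : ∀ X, φ X ≤ C * ENNReal.ofReal (frobeniusSq X)) (L : List (Matrix (Fin d) (Fin d) ℂ)) :
    ∃ D < ⊤, ∀ X, average φ L X ≤ D * ENNReal.ofReal (frobeniusSq X) := by
  induction L with
  | nil => exact ⟨C, hC, hφ⟩
  | cons P L ih =>
    obtain ⟨D, hD, hle⟩ := ih
    refine ⟨D * ENNReal.ofReal (frobeniusSq P) *
      ∫⁻ G, ENNReal.ofReal (frobeniusSq G) ∂(ginibre d), ENNReal.mul_lt_top
        (ENNReal.mul_lt_top hD ENNReal.ofReal_lt_top) lintegral_frobeniusSq_ginibre_lt_top,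
      fun X => ?_⟩
    have hm : Measurable fun G : Matrix (Fin d) (Fin d) ℂ => ENNReal.ofReal (frobeniusSq G) := by
      unfold frobeniusSq
      exact (Continuous.measurable (by fun_prop)).ennreal_ofReal
    calc average φ (P :: L) X
        ≤ ∫⁻ G, D * ENNReal.ofReal (frobeniusSq P) * ENNReal.ofReal (frobeniusSq G) *
            ENNReal.ofReal (frobeniusSq X) ∂(ginibre d) := by
          refine lintegral_mono fun G => (hle _).trans ?_
          simp only [mul_assoc]
          refine mul_le_mul_right ?_ D
          rw [← ENNReal.ofReal_mul (frobeniusSq_nonneg _), ← ENNReal.ofReal_mul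
            (frobeniusSq_nonneg _)]
          refine ENNReal.ofReal_le_ofReal ((frobeniusSq_mul_le _ _).trans ?_)
          exact mul_le_mul_of_nonneg_left (frobeniusSq_mul_le _ _) (frobeniusSq_nonneg _)
      _ = _ := by
          rw [lintegral_mul_const _ (hm.const_mul _), lintegral_const_mul _ hm]

end Averages

end RayleighProduct

namespace RayleighProduct

/-! ### Bounds and invariance of the log-determinant -/

section LogDet

open scoped ComplexOrder

variable {m n d : ℕ}

theorem exists_det_one_add_smul_eq_prod (X : Matrix (Fin m) (Fin n) ℂ) :
    ∃ l : Fin n → ℝ, (∀ i, 0 ≤ l i) ∧ (∑ i, (l i : ℂ) = (Xᴴ * X).trace) ∧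
      ∀ q : ℝ, (1 + (q : ℂ) • (Xᴴ * X)).det.re = ∏ i, (1 + q * l i) := by
  have hA : (Xᴴ * X).PosSemidef := Matrix.posSemidef_conjTranspose_mul_self X
  refine ⟨hA.isHermitian.eigenvalues, hA.eigenvalues_nonneg,
    hA.isHermitian.trace_eq_sum_eigenvalues.symm, fun q => ?_⟩
  set U := hA.isHermitian.eigenvectorUnitary
  set D : Matrix (Fin n) (Fin n) ℂ :=
    Matrix.diagonal (RCLike.ofReal ∘ hA.isHermitian.eigenvalues) with hD
  have h : 1 + (q : ℂ) • (Xᴴ * X) =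
      (U : Matrix (Fin n) (Fin n) ℂ) * (1 + (q : ℂ) • D) * star (U : Matrix (Fin n) (Fin n) ℂ) := by
    conv_lhs => rw [hA.isHermitian.spectral_theorem, Unitary.conjStarAlgAut_apply]
    rw [Matrix.mul_add, Matrix.add_mul, Matrix.mul_one, Unitary.mul_star_self_of_mem U.2,
      Matrix.mul_smul, Matrix.smul_mul]
  have hdet : (1 + (q : ℂ) • (Xᴴ * X)).det = (1 + (q : ℂ) • D).det := by
    rw [h, Matrix.det_mul_comm, ← Matrix.mul_assoc, Unitary.star_mul_self_of_mem U.2, Matrix.one_mul]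
  have hdiag : 1 + (q : ℂ) • D =
      Matrix.diagonal fun i => ((1 + q * hA.isHermitian.eigenvalues i : ℝ) : ℂ) := by
    rw [hD, ← Matrix.diagonal_one, ← Matrix.diagonal_smul, Matrix.diagonal_add]
    congr with i
    simp
  rw [hdet, hdiag, Matrix.det_diagonal, ← Complex.ofReal_prod, Complex.ofReal_re]

/-- `log det (1 + q Xᴴ X)`. -/
noncomputable def logDet (q : ℝ) (X : Matrix (Fin m) (Fin n) ℂ) : ℝ :=
  Real.log (1 + (q : ℂ) • (Xᴴ * X)).det.re

theorem logDet_nonneg {q : ℝ} (hq : 0 ≤ q) (X : Matrix (Fin m) (Fin n) ℂ) : 0 ≤ logDet q X := by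
  obtain ⟨l, hl, -, h⟩ := exists_det_one_add_smul_eq_prod X
  rw [logDet, h]
  refine Real.log_nonneg (Finset.one_le_prod fun i _ => ?_)
  have := mul_nonneg hq (hl i)
  linarith

/-- Apply `log (1 + x) ≤ x` to each eigenvalue; the eigenvalues sum to the trace of `Xᴴ X`. -/
theorem logDet_le {q : ℝ} (hq : 0 ≤ q) (X : Matrix (Fin d) (Fin d) ℂ) :
    logDet q X ≤ q * frobeniusSq X := by
  obtain ⟨l, hl, htr, h⟩ := exists_det_one_add_smul_eq_prod X
  have hpos : ∀ i, 0 < 1 + q * l i := fun i => by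
    have := mul_nonneg hq (hl i)
    linarith
  have hfrob : frobeniusSq X = ∑ i, l i := by
    have : (frobeniusSq X : ℂ) = ((∑ i, l i : ℝ) : ℂ) := by
      push_cast
      rw [htr, frobeniusSq, Matrix.trace, Finset.sum_comm]
      push_cast
      refine Finset.sum_congr rfl fun i _ => ?_
      rw [Matrix.diag_apply, Matrix.mul_apply]
      refine Finset.sum_congr rfl fun j _ => ?_
      rw [Matrix.conjTranspose_apply, RCLike.star_def, Complex.conj_mul']
    exact_mod_cast this
  rw [logDet, h, Real.log_prod fun i _ => (hpos i).ne', hfrob, Finset.mul_sum]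
  refine Finset.sum_le_sum fun i _ => ?_
  have := Real.log_le_sub_one_of_pos (hpos i)
  linarith

theorem measurable_logDet (q : ℝ) :
    Measurable (logDet q : Matrix (Fin d) (Fin d) ℂ → ℝ) := by
  refine Real.measurable_log.comp (Continuous.measurable ?_)
  exact Complex.continuous_re.comp (Continuous.matrix_det (by fun_prop))

theorem isBiunitarilyInvariant_logDet (q : ℝ) :
    IsBiunitarilyInvariant fun X : Matrix (Fin d) (Fin d) ℂ => ENNReal.ofReal (logDet q X) := by
  intro W hW X
  have h1 : Wᴴ * W = 1 := Matrix.mem_unitaryGroup_iff'.1 hW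
  have h2 : W * Wᴴ = 1 := Matrix.mem_unitaryGroup_iff.1 hW
  constructor
  · have : (W * X)ᴴ * (W * X) = Xᴴ * X := by
      rw [Matrix.conjTranspose_mul, Matrix.mul_assoc, ← Matrix.mul_assoc Wᴴ, h1, Matrix.one_mul]
    simp only [logDet, this]
  · have : (1 + (q : ℂ) • ((X * W)ᴴ * (X * W))).det = (1 + (q : ℂ) • (Xᴴ * X)).det := by
      have h : (q : ℂ) • ((X * W)ᴴ * (X * W)) = (Wᴴ * ((q : ℂ) • (Xᴴ * X))) * W := by
        simp only [Matrix.conjTranspose_mul, Matrix.mul_assoc, Matrix.mul_smul, Matrix.smul_mul]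
      rw [h, Matrix.det_one_add_mul_comm, ← Matrix.mul_assoc, h2, Matrix.one_mul]
    simp only [logDet, this]

/-- `A` cancels in the Gram matrix, and `det (1 + B C) = det (1 + C B)` removes `B`. This permits
padding to size `d`. -/
theorem logDet_isometry_mul_mul {m' n' : ℕ} (q : ℝ) {A : Matrix (Fin m') (Fin m) ℂ}
    {B : Matrix (Fin n') (Fin n) ℂ} (hA : Aᴴ * A = 1) (hB : Bᴴ * B = 1)
    (X : Matrix (Fin m) (Fin n) ℂ) : logDet q (A * X * Bᴴ) = logDet q X := by
  have h : (q : ℂ) • ((A * X * Bᴴ)ᴴ * (A * X * Bᴴ)) = B * ((q : ℂ) • (Xᴴ * X) * Bᴴ) := by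
    calc (q : ℂ) • ((A * X * Bᴴ)ᴴ * (A * X * Bᴴ))
        = (q : ℂ) • (B * (Xᴴ * ((Aᴴ * A) * X) * Bᴴ)) := by
          simp only [Matrix.conjTranspose_mul, Matrix.conjTranspose_conjTranspose,
            Matrix.mul_assoc]
      _ = _ := by rw [hA, Matrix.one_mul, Matrix.smul_mul, Matrix.mul_smul]
  rw [logDet, h, Matrix.det_one_add_mul_comm, Matrix.mul_assoc, hB, Matrix.mul_one, logDet]

end LogDet

/-! ### Alternating products of fixed and Gaussian matrices -/

section IteratedProduct

variable {d : ℕ}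

/-- The matrix `Pₖ Gₖ ⋯ P₁ G₁ X`. -/
def iteratedProduct : {K : ℕ} → (P G : Fin K → Matrix (Fin d) (Fin d) ℂ) →
    Matrix (Fin d) (Fin d) ℂ → Matrix (Fin d) (Fin d) ℂ
  | 0, _, _, X => X
  | _ + 1, P, G, X => iteratedProduct (fun k => P k.succ) (fun k => G k.succ) (P 0 * G 0 * X)

theorem eq_iteratedProduct {K : ℕ} (P G : Fin K → Matrix (Fin d) (Fin d) ℂ)
    (B : Fin (K + 1) → Matrix (Fin d) (Fin d) ℂ)
    (hB : ∀ k : Fin K, B k.succ = P k * G k * B k.castSucc) :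
    B (Fin.last K) = iteratedProduct P G (B 0) := by
  induction K with
  | zero => rfl
  | succ K ih =>
    have h := ih (fun k => P k.succ) (fun k => G k.succ) (fun k => B k.succ)
      fun k => hB k.succ
    rw [← Fin.succ_last, h, iteratedProduct]
    congr 1
    exact hB 0

theorem continuous_iteratedProduct {K : ℕ} (P : Fin K → Matrix (Fin d) (Fin d) ℂ) :
    Continuous fun p : (Fin K → Matrix (Fin d) (Fin d) ℂ) × Matrix (Fin d) (Fin d) ℂ =>
      iteratedProduct P p.1 p.2 := by
  induction K with
  | zero => exact continuous_snd
  | succ K ih =>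
    exact (ih fun k => P k.succ).comp
      (f := fun p : (Fin (K + 1) → Matrix (Fin d) (Fin d) ℂ) × Matrix (Fin d) (Fin d) ℂ =>
        ((fun k => p.1 k.succ : Fin K → Matrix (Fin d) (Fin d) ℂ), P 0 * p.1 0 * p.2))
      (by fun_prop)

theorem lintegral_iteratedProduct {φ : Matrix (Fin d) (Fin d) ℂ → ENNReal} (hφ : Measurable φ)
    {K : ℕ} (P : Fin K → Matrix (Fin d) (Fin d) ℂ) (X : Matrix (Fin d) (Fin d) ℂ) :
    ∫⁻ G, φ (iteratedProduct P G X) ∂(Measure.pi fun _ : Fin K => ginibre d) =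
      average φ (List.ofFn P) X := by
  induction K generalizing X with
  | zero => simp [iteratedProduct, average]
  | succ K ih =>
    have hmp := measurePreserving_piFinSuccAbove (fun _ : Fin (K + 1) => ginibre d) 0
    have hm : Measurable fun p : Matrix (Fin d) (Fin d) ℂ ×
        (Fin K → Matrix (Fin d) (Fin d) ℂ) =>
          φ (iteratedProduct (fun k => P k.succ) p.2 (P 0 * p.1 * X)) := by
      refine hφ.comp (Continuous.measurable ?_)
      exact (continuous_iteratedProduct fun k => P k.succ).comp
        (f := fun p : Matrix (Fin d) (Fin d) ℂ × (Fin K → Matrix (Fin d) (Fin d) ℂ) =>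
          (p.2, P 0 * p.1 * X)) (by fun_prop)
    calc ∫⁻ G, φ (iteratedProduct P G X) ∂(Measure.pi fun _ : Fin (K + 1) => ginibre d)
        = ∫⁻ p, φ (iteratedProduct (fun k => P k.succ) p.2 (P 0 * p.1 * X))
            ∂((ginibre d).prod (Measure.pi fun _ : Fin K => ginibre d)) :=
          hmp.lintegral_comp hm
      _ = average φ (List.ofFn P) X := by
          rw [lintegral_prod _ hm.aemeasurable, List.ofFn_succ, average]
          exact lintegral_congr fun G => ih (fun k => P k.succ) (P 0 * G * X)

end IteratedProduct

/-! ### Channels as corner blocks, and the permutation invariance -/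

section Embedding

/-- The matrix of the inclusion of the first `n` coordinates into `d` coordinates. -/
def inclusion (d n : ℕ) : Matrix (Fin d) (Fin n) ℂ :=
  Matrix.of fun i j => if (i : ℕ) = j then 1 else 0

theorem inclusion_conjTranspose_mul_self {d n : ℕ} (h : n ≤ d) :
    (inclusion d n)ᴴ * inclusion d n = 1 := by
  ext i j
  have hi : ∀ (i : Fin n) (k : Fin d), (k : ℕ) = i ↔ k = Fin.castLE h i := fun i k => by
    rw [Fin.ext_iff, Fin.val_castLE]
  simp [Matrix.mul_apply, inclusion, hi, Matrix.one_apply, eq_comm]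

theorem isHermitian_inclusion_mul_conjTranspose (d n : ℕ) :
    (inclusion d n * (inclusion d n)ᴴ).IsHermitian :=
  Matrix.isHermitian_mul_conjTranspose_self _

theorem inclusion_conjTranspose_mul_mul {d m n : ℕ} (hm : m ≤ d) (hn : n ≤ d)
    (G : Matrix (Fin d) (Fin d) ℂ) :
    (inclusion d m)ᴴ * G * inclusion d n = G.submatrix (Fin.castLE hm) (Fin.castLE hn) := by
  ext i j
  have hi : ∀ k : Fin d, (k : ℕ) = i ↔ k = Fin.castLE hm i := fun k => by
    rw [Fin.ext_iff, Fin.val_castLE]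
  have hj : ∀ k : Fin d, (k : ℕ) = j ↔ k = Fin.castLE hn j := fun k => by
    rw [Fin.ext_iff, Fin.val_castLE]
  simp [Matrix.mul_apply, inclusion, hi, hj]

variable {K d : ℕ} {N : Fin (K + 1) → ℕ}

/-- The channels obtained as upper left blocks of `d × d` matrices. -/
def restrictChannels (hN : ∀ k, N k ≤ d) (G : Fin K → Matrix (Fin d) (Fin d) ℂ) : Channels N :=
  fun k i j => G k (Fin.castLE (hN _) i) (Fin.castLE (hN _) j)

theorem measurePreserving_restrictChannels (hN : ∀ k, N k ≤ d) :
    MeasurePreserving (restrictChannels hN) (Measure.pi fun _ : Fin K => ginibre d)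
      (rayleighLaw N) := by
  refine measurePreserving_pi (fun _ : Fin K => ginibre d) _ (f := fun k (G : Fin d → Fin d → ℂ)
    (i : Fin (N k.succ)) (j : Fin (N k.castSucc)) => G (Fin.castLE (hN _) i) (Fin.castLE (hN _) j))
    fun k => ?_
  exact (measurePreserving_pi (fun _ : Fin (N k.succ) => Measure.pi fun _ : Fin d => complexGaussian)
    (fun _ => Measure.pi fun _ : Fin (N k.castSucc) => complexGaussian)
    fun _ => measurePreserving_comp_injective complexGaussian
      (Fin.castLE_injective (hN k.castSucc))).comp (measurePreserving_comp_injective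
        (Measure.pi fun _ : Fin d => complexGaussian) (Fin.castLE_injective (hN k.succ)))

theorem inclusion_mul_productChannel_mul (hN : ∀ k, N k ≤ d)
    (G : Fin K → Matrix (Fin d) (Fin d) ℂ) :
    inclusion d (N (Fin.last K)) * productChannel (restrictChannels hN G) * (inclusion d (N 0))ᴴ =
      iteratedProduct (fun k : Fin K => inclusion d (N k.succ) * (inclusion d (N k.succ))ᴴ) G
        (inclusion d (N 0) * (inclusion d (N 0))ᴴ) := by
  let H : (k : Fin (K + 1)) → Matrix (Fin (N k)) (Fin (N 0)) ℂ := fun k =>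
    Fin.induction (motive := fun k => Matrix (Fin (N k)) (Fin (N 0)) ℂ)
      1 (fun k P => Matrix.of (restrictChannels hN G k) * P) k
  have hH : ∀ k : Fin K, H k.succ = Matrix.of (restrictChannels hN G k) * H k.castSucc :=
    fun k => rfl
  have h := eq_iteratedProduct
    (fun k : Fin K => inclusion d (N k.succ) * (inclusion d (N k.succ))ᴴ) G
    (fun k => inclusion d (N k) * H k * (inclusion d (N 0))ᴴ) fun k => by
      have hQ : Matrix.of (restrictChannels hN G k) =
          (inclusion d (N k.succ))ᴴ * G k * inclusion d (N k.castSucc) :=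
        (inclusion_conjTranspose_mul_mul _ _ _).symm
      simp only [hH, hQ, Matrix.mul_assoc]
  have h0 : H 0 = 1 := rfl
  simp only [h0, Matrix.mul_one] at h
  exact h

theorem capacity_restrictChannels (hN : ∀ k, N k ≤ d) (q : ℝ)
    (G : Fin K → Matrix (Fin d) (Fin d) ℂ) :
    capacity q (restrictChannels hN G) =
      logDet q (iteratedProduct (fun k : Fin K => inclusion d (N k.succ) *
        (inclusion d (N k.succ))ᴴ) G (inclusion d (N 0) * (inclusion d (N 0))ᴴ)) := by
  rw [← inclusion_mul_productChannel_mul hN, logDet_isometry_mul_mul q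
    (inclusion_conjTranspose_mul_self (hN _)) (inclusion_conjTranspose_mul_self (hN _))]
  rfl

theorem continuous_productChannel :
    Continuous (productChannel : Channels N → Matrix (Fin (N (Fin.last K))) (Fin (N 0)) ℂ) := by
  have h : ∀ k : Fin (K + 1), Continuous fun Q : Channels N =>
      Fin.induction (motive := fun k => Matrix (Fin (N k)) (Fin (N 0)) ℂ)
        1 (fun k P => Matrix.of (Q k) * P) k := by
    intro k
    induction k using Fin.induction with
    | zero => exact continuous_const
    | succ k ih =>
      simp only [Fin.induction_succ]
      exact Continuous.matrix_mul (continuous_apply k) ih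
  exact h (Fin.last K)

theorem measurable_capacity (q : ℝ) : Measurable (capacity q : Channels N → ℝ) := by
  refine Real.measurable_log.comp (Continuous.measurable ?_)
  have h := continuous_productChannel (N := N)
  exact Complex.continuous_re.comp (Continuous.matrix_det (by fun_prop))

theorem capacity_nonneg {q : ℝ} (hq : 0 ≤ q) (Q : Channels N) : 0 ≤ capacity q Q :=
  logDet_nonneg hq (productChannel Q)

/-- The right side sees `N` only through the list of projections, so permuting `N` permutes that
list. The size `d` is any common bound. -/
theorem lintegral_capacity (hN : ∀ k, N k ≤ d) (q : ℝ) :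
    ∫⁻ Q, ENNReal.ofReal (capacity q Q) ∂(rayleighLaw N) =
      productAverage (fun X : Matrix (Fin d) (Fin d) ℂ => ENNReal.ofReal (logDet q X))
        (List.ofFn fun k => inclusion d (N k) * (inclusion d (N k))ᴴ) := by
  rw [← (measurePreserving_restrictChannels hN).lintegral_comp
    (measurable_capacity q).ennreal_ofReal]
  simp only [capacity_restrictChannels]
  rw [lintegral_iteratedProduct (φ := fun X => ENNReal.ofReal (logDet q X))
    (measurable_logDet q).ennreal_ofReal, List.ofFn_succ, productAverage]

theorem integrable_capacity {q : ℝ} (hq : 0 ≤ q) :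
    Integrable (fun Q : Channels N => capacity q Q) (rayleighLaw N) := by
  refine ⟨(measurable_capacity q).aestronglyMeasurable, ?_⟩
  rw [hasFiniteIntegral_iff_ofReal (ae_of_all _ (capacity_nonneg hq)), lintegral_capacity
    (d := ∑ k, N k) (fun k => Finset.single_le_sum (fun _ _ => Nat.zero_le _) (Finset.mem_univ k)),
    List.ofFn_succ, productAverage]
  obtain ⟨D, hD, h⟩ := exists_average_le (d := ∑ k, N k)
    (φ := fun X => ENNReal.ofReal (logDet q X)) (ENNReal.ofReal_lt_top (r := q))
    (fun X => by
      rw [← ENNReal.ofReal_mul hq]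
      exact ENNReal.ofReal_le_ofReal (logDet_le hq X))
    (List.ofFn fun k : Fin K => inclusion _ (N k.succ) * (inclusion _ (N k.succ))ᴴ)
  exact (h _).trans_lt (ENNReal.mul_lt_top hD ENNReal.ofReal_lt_top)

theorem ergodicCapacity_comp_perm {q : ℝ} (hq : 0 ≤ q) (σ : Equiv.Perm (Fin (K + 1))) :
    ergodicCapacity (N ∘ σ) q = ergodicCapacity N q := by
  have hN : ∀ k, N k ≤ ∑ k, N k := fun k =>
    Finset.single_le_sum (fun _ _ => Nat.zero_le _) (Finset.mem_univ k)
  have hE : ∀ N' : Fin (K + 1) → ℕ, ergodicCapacity N' q =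
      (∫⁻ Q, ENNReal.ofReal (capacity q Q) ∂(rayleighLaw N')).toReal := fun N' =>
    integral_eq_lintegral_of_nonneg_ae (ae_of_all _ (capacity_nonneg hq))
      (measurable_capacity q).aestronglyMeasurable
  -- The same `d` serves both dimension vectors, so both lists consist of matrices of one size.
  rw [hE, hE, lintegral_capacity (N := N ∘ σ) (fun k => hN (σ k)), lintegral_capacity hN]
  congr 1
  refine productAverage_perm (measurable_logDet q).ennreal_ofReal (isBiunitarilyInvariant_logDet q)
    (σ.ofFn_comp_perm fun k => inclusion _ (N k) * (inclusion _ (N k))ᴴ) fun P hP => ?_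
  obtain ⟨k, rfl⟩ := List.mem_ofFn.1 hP
  exact isHermitian_inclusion_mul_conjTranspose _ _

end Embedding

end RayleighProduct

theorem mainTheorem5 {K : ℕ} (N : Fin (K + 1) → ℕ) (q : ℝ) (hq : 0 ≤ q)
    (σ : Equiv.Perm (Fin (K + 1))) :
    MeasureTheory.Integrable (fun Q : RayleighProduct.Channels N => RayleighProduct.capacity q Q)
      (RayleighProduct.rayleighLaw N) ∧
    MeasureTheory.Integrable
      (fun Q : RayleighProduct.Channels (N ∘ σ) => RayleighProduct.capacity q Q)
      (RayleighProduct.rayleighLaw (N ∘ σ)) ∧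
    RayleighProduct.ergodicCapacity (N ∘ σ) q = RayleighProduct.ergodicCapacity N q :=
  ⟨RayleighProduct.integrable_capacity hq, RayleighProduct.integrable_capacity hq,
    RayleighProduct.ergodicCapacity_comp_perm hq σ⟩
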